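/- All graphs are finite and simple; $|G|$ denotes the number of vertices of $G$. A graph $G$ is $\varepsilon$-sparse if every vertex has degree less than $\varepsilon|G|$. Two disjoint sets of vertices are anticomplete if there is no edge between them. $G$ is $(\alpha,\beta)$-coherent if there do not exist disjoint anticomplete sets $A,B\subseteq V(G)$ with $|A|\ge\alpha$ and $|B|\ge\beta$. A levelling in $G$ is a sequence $\mathcal L=(L_0,\ldots,L_k)$ of pairwise disjoint subsets of $V(G)$ with $k\ge 1$ such that $|L_0|=1$; for $1\le i\le k$ every vertex of $L_i$ has a neighbour in $L_{i-1}$; and for $2\le i\le k$ there is no edge between $L_0\cup\cdots\cup L_{i-2}$ and $L_i$. Its height is $k$, its apex is the vertex of $L_0$, its base is $L_k$, its penultimate level is $L_{k-1}$, its heart is $L_0\cup\cdots\cup L_{k-1}$, and $V(\mathcal L)=L_0\cup\cdots\cup L_k$. A lobster of length $n\ge 1$ in $G$ consists of a vertex $a$ (its apex) and levellings $\mathcal L_1,\ldots,\mathcal L_n$ in $G$ (its members), all with apex $a$ and with hearts $H_1,\ldots,H_n$, such that $H_1\setminus\{a\},\ldots,H_n\setminus\{a\}$ are pairwise disjoint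 and, for all distinct $i,j$, every edge $uv$ of $G$ with $u\in H_i\setminus\{a\}$ and $v\in V(\mathcal L_j)\setminus\{a\}$ has $u$ in the penultimate level of $\mathcal L_i$ and $v$ in the base of $\mathcal L_j$. Its height is the maximum of the heights of its members, its mass is the minimum cardinality of the bases of its members, and its heart is $H_1\cup\cdots\cup H_n$. A troupe of $m$ lobsters is a set $\{\mathcal T_1,\ldots,\mathcal T_m\}$ of $m$ lobsters such that (i) for $1\le i<j\le m$, the hearts of $\mathcal T_i$ and $\mathcal T_j$ are disjoint and anticomplete; and (ii) whenever $\mathcal L=(L_0,\ldots,L_k)$ and $\mathcal M$ are different members of lobsters among $\mathcal T_1,\ldots,\mathcal T_m$ (possibly of the same lobster), there is no edge between $L_0\cup\cdots\cup L_{k-2}$ and the base of $\mathcal M$. Theorem. Let $c>0$ be such that $1/c$ is an integer, let $m,n\ge 1$ be integers, and let $\varepsilon$ be given by $$\varepsilon^{-1}=\bigl(2^{2^{2n}}+3(m-1)n\bigr)\,(2+2/c)^{mn}.$$ If $G$ is an $\varepsilon$-sparse $(\varepsilon|G|^{1-c},\varepsilon|G|)$-coherent graph with $|G|>1$, then $G$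 contains a troupe of $m$ lobsters, each of length $n$, of height at most $2+2/c$, and of mass at least $\varepsilon|G|$. -/

import Mathlib

namespace PurePairs

variable {V : Type*}

/-- No edge of `G` joins a vertex of `A` to a vertex of `B` (disjointness of anticomplete sets is
always stated separately below). -/
def Anticomplete (G : SimpleGraph V) (A B : Set V) : Prop :=
  ∀ a ∈ A, ∀ b ∈ B, ¬ G.Adj a b

/-- Every vertex of `B` has a neighbour in `A`. -/
def Covers (G : SimpleGraph V) (A B : Set V) : Prop :=
  ∀ b ∈ B, ∃ a ∈ A, G.Adj a b

/-- `G` is `ε`-sparse: every vertex has degree less than `ε |G|`. -/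
def IsSparse (G : SimpleGraph V) (ε : ℝ) : Prop :=
  ∀ v : V, ((G.neighborSet v).ncard : ℝ) < ε * (Nat.card V : ℝ)

/-- `G` is `(α, β)`-coherent: there are no disjoint anticomplete sets `A`, `B` of vertices with
`|A| ≥ α` and `|B| ≥ β`. -/
def IsCoherent (G : SimpleGraph V) (α β : ℝ) : Prop :=
  ¬ ∃ A B : Set V, Disjoint A B ∧ Anticomplete G A B ∧
    α ≤ (A.ncard : ℝ) ∧ β ≤ (B.ncard : ℝ)

/-- A levelling `(L_0, …, L_k)` in `G`, with `k = height ≥ 1` and `L_0 = {apex}`. The finite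
sequence is stored as a function on `ℕ` that is empty beyond `k`. -/
structure Levelling (G : SimpleGraph V) where
  height : ℕ
  one_le_height : 1 ≤ height
  apex : V
  level : ℕ → Set V
  level_of_height_lt : ∀ i, height < i → level i = ∅
  level_zero : level 0 = {apex}
  level_disjoint : ∀ i j, i ≠ j → Disjoint (level i) (level j)
  level_covers : ∀ i, i < height → Covers G (level i) (level (i + 1))
  level_anticomplete : ∀ i j, i + 2 ≤ j → j ≤ height → Anticomplete G (level i) (level j)

namespace Levelling

variable {G : SimpleGraph V}

/-- `L_0 ∪ ⋯ ∪ L_k`. -/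
def vertexSet (L : Levelling G) : Set V := {v | ∃ i, i ≤ L.height ∧ v ∈ L.level i}

/-- The base `L_k`. -/
def base (L : Levelling G) : Set V := L.level L.height

/-- The heart `L_0 ∪ ⋯ ∪ L_{k-1}`. -/
def heart (L : Levelling G) : Set V := L.vertexSet \ L.base

/-- The penultimate level `L_{k-1}` (recall that `k ≥ 1`). -/
def penultimate (L : Levelling G) : Set V := L.level (L.height - 1)

/-- `L_0 ∪ ⋯ ∪ L_{k-2}`; it is empty when `k = 1`. -/
def inner (L : Levelling G) : Set V := {v | ∃ i, i + 2 ≤ L.height ∧ v ∈ L.level i}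

end Levelling

/-- A lobster of length `n ≥ 1` in `G`. -/
structure Lobster (G : SimpleGraph V) (n : ℕ) where
  one_le_length : 1 ≤ n
  apex : V
  member : Fin n → Levelling G
  member_apex : ∀ i, (member i).apex = apex
  heart_disjoint : ∀ i j, i ≠ j →
    Disjoint ((member i).heart \ {apex}) ((member j).heart \ {apex})
  edge_condition : ∀ i j, i ≠ j →
    ∀ u ∈ (member i).heart \ {apex}, ∀ v ∈ (member j).vertexSet \ {apex},
      G.Adj u v → u ∈ (member i).penultimate ∧ v ∈ (member j).base

namespace Lobster

variable {G : SimpleGraph V} {n : ℕ}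

/-- The maximum of the heights of the members. -/
def height (T : Lobster G n) : ℕ := Finset.univ.sup fun i => (T.member i).height

/-- The minimum of the cardinalities of the bases of the members (there is at least one member). -/
noncomputable def mass (T : Lobster G n) : ℕ := ⨅ i, (T.member i).base.ncard

/-- The union of the hearts of the members. -/
def heart (T : Lobster G n) : Set V := ⋃ i, (T.member i).heart

end Lobster

/-- `T_1, …, T_m` form a troupe of `m` lobsters of length `n`. (They are then distinct, since their
hearts are nonempty and pairwise disjoint.) The second condition ranges over all pairs of members
with different indices. -/
structure IsTroupe {G : SimpleGraph V} {m n : ℕ} (T : Fin m → Lobster G n) : Prop where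
  heart_disjoint : ∀ i j, i ≠ j → Disjoint (T i).heart (T j).heart
  heart_anticomplete : ∀ i j, i ≠ j → Anticomplete G (T i).heart (T j).heart
  inner_anticomplete : ∀ (i j : Fin m) (p q : Fin n), (i, p) ≠ (j, q) →
    Anticomplete G ((T i).member p).inner ((T j).member q).base

end PurePairs

namespace PurePairs

/-! Write `N = |G|`, `e = εN`, `α = εN^(1-c)`, `q = N^c` and `r = 1/c - 1`, so that `αq = e` and `α
≤ q^r`. Growth by a factor `q` for `r` steps yields a ball with at least `α` vertices, and coherence
makes such a ball see all but fewer than `e` of the vertices elsewhere (`exists_large_ball`).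
Deleting farthest vertices one at a time keeps the radius, while sparsity makes the covered amount
drop by less than `e` each time; so connected sets of radius `r` can be tuned to cover about half of
a target (`exists_half_cover`).

A potential argument on `2^n` parts iterates this and yields `n` pairwise anticomplete connected
sets with a common neighbour `a` (`exists_coveringFamily_of_parts`). Joining `a` to each and pruning
gives a skeleton whose members are small but have large neighbourhoods. Removing those
neighbourhoods and repeating gives `m` mutually anticomplete skeletons (`exists_skeletons`).

The bases come from a pigeonhole (`exists_troupe`). Each vertex outside the skeletons records how
far from the apex it first attaches to each of the `mn` members. Every member has many neighbours
with one common record, and it takes as its base the class of vertices, possibly found at another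
member, that attaches to it closest to its apex. Then no base touches the inner levels of any
member. -/

/-- The set of vertices with a neighbour in `H`. -/
def nbhd {V : Type*} (G : SimpleGraph V) (H : Set V) : Set V := {x | ∃ y ∈ H, G.Adj y x}

/-- The ball of radius `r` about `a` in the subgraph induced on `H ∪ {a}`. -/
def ball {V : Type*} (G : SimpleGraph V) (H : Set V) (a : V) : ℕ → Set V
  | 0 => {a}
  | r + 1 => ball G H a r ∪ H ∩ nbhd G (ball G H a r)

/-! ### Balls in induced subgraphs, and pruning at fixed radius. -/

section Ball

variable {V : Type*} {G : SimpleGraph V} {H H' X : Set V} {a v x y : V} {i j r : ℕ}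

theorem nbhd_mono (h : H ⊆ H') : nbhd G H ⊆ nbhd G H' := fun _ ⟨y, hy, hyx⟩ => ⟨y, h hy, hyx⟩

theorem mem_ball_succ :
    x ∈ ball G H a (i + 1) ↔ x ∈ ball G H a i ∨ x ∈ H ∧ ∃ y ∈ ball G H a i, G.Adj y x :=
  Iff.rfl

theorem ball_mono (h : i ≤ j) : ball G H a i ⊆ ball G H a j := by
  induction j, h using Nat.le_induction with
  | base => exact subset_rfl
  | succ j _ ih => exact ih.trans Set.subset_union_left

theorem ball_mono_set (h : H ⊆ H') : ball G H a i ⊆ ball G H' a i := by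
  induction i with
  | zero => exact subset_rfl
  | succ i ih => exact Set.union_subset_union ih (Set.inter_subset_inter h (nbhd_mono ih))

theorem mem_ball_self : a ∈ ball G H a i := ball_mono (Nat.zero_le i) rfl

theorem ball_subset (ha : a ∈ H) : ball G H a i ⊆ H := by
  induction i with
  | zero => rintro x rfl; exact ha
  | succ i ih => exact Set.union_subset ih Set.inter_subset_left

theorem ball_subset_ball_ball (h : i ≤ r) : ball G X a i ⊆ ball G (ball G X a r) a i := by
  induction i with
  | zero => exact subset_rfl
  | succ i ih =>
    intro x hx
    have hxr := ball_mono h hx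
    rcases mem_ball_succ.1 hx with hx | ⟨_, y, hy, hyx⟩
    · exact Or.inl (ih (by omega) hx)
    · exact Or.inr ⟨hxr, y, ih (by omega) hy, hyx⟩

theorem ball_trans (hy : y ∈ ball G H a i) (hx : x ∈ ball G H y j) :
    x ∈ ball G H a (i + j) := by
  induction j generalizing x with
  | zero => obtain rfl : x = y := hx; exact hy
  | succ j ih =>
    rcases mem_ball_succ.1 hx with hx | ⟨hxH, z, hz, hzx⟩
    · exact Or.inl (ih hx)
    · exact Or.inr ⟨hxH, z, ih hz, hzx⟩

theorem ball_symm (ha : a ∈ H) (hx : x ∈ ball G H a i) : a ∈ ball G H x i := by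
  induction i generalizing x with
  | zero => exact (show x = a from hx).symm
  | succ i ih =>
    rcases mem_ball_succ.1 hx with hx | ⟨_, y, hy, hyx⟩
    · exact Or.inl (ih hx)
    · have h1 : y ∈ ball G H x 1 := Or.inr ⟨ball_subset ha hy, x, rfl, hyx.symm⟩
      have := ball_trans h1 (ih hy)
      rwa [Nat.add_comm] at this

/-- A connected set of radius `r` together with an attached vertex `a` has radius at most `2r + 1`
about `a`. -/
theorem insert_subset_ball (hv : v ∈ H) (hH : H ⊆ ball G H v r) (hx : x ∈ H) (hax : G.Adj a x) :
    insert a H ⊆ ball G (insert a H) a (2 * r + 1) := by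
  rintro y (rfl | hy)
  · exact mem_ball_self
  · have hsub := Set.subset_insert a H
    have h1 : x ∈ ball G (insert a H) a 1 := Or.inr ⟨hsub hx, a, rfl, hax⟩
    have h2 : v ∈ ball G (insert a H) x r := ball_mono_set hsub (ball_symm hv (hH hx))
    have h3 : y ∈ ball G (insert a H) v r := ball_mono_set hsub (hH hy)
    have := ball_trans (ball_trans h1 h2) h3
    exact ball_mono (by omega) this

/-- A shortest path from `a` to any other vertex avoids a vertex at maximum distance, so deleting
that vertex changes no other distance. -/
theorem exists_farthest (ha : a ∈ H) (hH : H ⊆ ball G H a r) (hne : H ≠ {a}) :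
    ∃ x ∈ H, x ≠ a ∧ H \ {x} ⊆ ball G (H \ {x}) a r := by
  classical
  have hex : ∃ t, H ⊆ ball G H a t := ⟨r, hH⟩
  obtain ⟨t, ht⟩ : ∃ t, Nat.find hex = t := ⟨_, rfl⟩
  have hsub := ht ▸ Nat.find_spec hex
  have htr : t ≤ r := ht ▸ Nat.find_min' hex hH
  cases t with
  | zero => exact absurd (Set.Subset.antisymm hsub (Set.singleton_subset_iff.2 ha)) hne
  | succ t =>
    obtain ⟨x, hxH, hx⟩ := Set.not_subset.1 (Nat.find_min hex (m := t) (by omega))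
    refine ⟨x, hxH, fun h => hx (h ▸ mem_ball_self), ?_⟩
    have key : ∀ i ≤ t, ball G H a i ⊆ ball G (H \ {x}) a i := by
      intro i
      induction i with
      | zero => exact fun _ => subset_rfl
      | succ i ih =>
        intro hi y hy
        have hyx : y ≠ x := fun h => hx (h ▸ ball_mono hi hy)
        rcases mem_ball_succ.1 hy with hy | ⟨hyH, z, hz, hzy⟩
        · exact Or.inl (ih (by omega) hy)
        · exact Or.inr ⟨⟨hyH, hyx⟩, z, ih (by omega) hz, hzy⟩
    rintro y ⟨hyH, hyx⟩
    refine ball_mono htr ?_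
    rcases mem_ball_succ.1 (hsub hyH) with hy | ⟨_, z, hz, hzy⟩
    · exact Or.inl (key t le_rfl hy)
    · exact Or.inr ⟨⟨hyH, hyx⟩, z, key t le_rfl hz, hzy⟩

/-- A set of radius at most `r` about `a` with a property `P` can be cut down, keeping its radius,
to one that just has `P`. -/
theorem exists_critical_subset [Finite V] (P : Set V → Prop) (hP0 : ¬ P ∅) (ha : a ∈ H)
    (hH : H ⊆ ball G H a r) (hP : P H) :
    ∃ H' ⊆ H, a ∈ H' ∧ H' ⊆ ball G H' a r ∧ P H' ∧ ∃ x ∈ H', ¬ P (H' \ {x}) := by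
  obtain ⟨N, hN⟩ : ∃ N, H.ncard = N := ⟨_, rfl⟩
  induction N generalizing H with
  | zero =>
    rw [Set.ncard_eq_zero] at hN
    exact absurd (hN ▸ hP) hP0
  | succ N ih =>
    by_cases hne : H = {a}
    · subst hne
      exact ⟨{a}, subset_rfl, rfl, hH, hP, a, rfl, by simpa using hP0⟩
    obtain ⟨x, hx, hxa, hball⟩ := exists_farthest ha hH hne
    by_cases hPx : P (H \ {x})
    · obtain ⟨H', hH', h⟩ := ih (H := H \ {x}) ⟨ha, hxa.symm⟩ hball hPx
        (by rw [Set.ncard_sdiff_singleton_of_mem hx, hN]; rfl)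
      exact ⟨H', hH'.trans Set.sdiff_subset, h⟩
    · exact ⟨H, subset_rfl, ha, hH, hP, x, hx, hPx⟩

end Ball

/-- Every degree is less than `e`, and a set anticomplete to, and disjoint from, some set with at
least `α` vertices has less than `e` vertices. -/
structure SparseCoherent {V : Type*} (G : SimpleGraph V) (α e : ℝ) : Prop where
  deg : ∀ v, ((G.neighborSet v).ncard : ℝ) < e
  coh : ∀ A B : Set V, Disjoint A B → Anticomplete G A B → α ≤ A.ncard → (B.ncard : ℝ) < e

theorem cast_ncard_union_le {V : Type*} (A B : Set V) :
    ((A ∪ B).ncard : ℝ) ≤ A.ncard + B.ncard := by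
  exact_mod_cast Set.ncard_union_le A B

/-! ### Growing connected sets from sparsity and coherence. -/

section Growth

variable {V : Type*} [Finite V] {G : SimpleGraph V} {α e q : ℝ} {r : ℕ}

theorem cast_ncard_le {A B : Set V} (h : A ⊆ B) : (A.ncard : ℝ) ≤ B.ncard :=
  Nat.cast_le.2 (Set.ncard_le_ncard h)

theorem cast_ncard_le_diff_add (A B : Set V) :
    (A.ncard : ℝ) ≤ (A \ B).ncard + (B ∩ A).ncard := by
  refine (cast_ncard_le ?_).trans (cast_ncard_union_le _ _)
  intro x hx
  by_cases hB : x ∈ B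
  · exact Or.inr ⟨hB, hx⟩
  · exact Or.inl ⟨hx, hB⟩

/-- Every large enough set contains a large ball of radius `r`. -/
theorem SparseCoherent.exists_large_ball (h : SparseCoherent G α e) (hα : 0 < α) (hαe : α ≤ e)
    (hq : α * q = e) (hr : α ≤ q ^ r) {X : Set V} (hX : 3 * e ≤ X.ncard) :
    ∃ v ∈ X, α ≤ (ball G X v r).ncard := by
  have hq0 : 0 < q := by
    by_contra hneg
    nlinarith
  -- A small set that expands badly in `X`. A maximal one is removed, so that balls in the rest must
  -- expand.
  let P : Set V → Prop := fun A =>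
    A ⊆ X ∧ (A.ncard : ℝ) < α ∧ ((A ∪ X ∩ nbhd G A).ncard : ℝ) ≤ q * A.ncard
  have hP0 : P ∅ := by
    refine ⟨Set.empty_subset _, by simpa using hα, ?_⟩
    have : nbhd G (∅ : Set V) = ∅ := by ext; simp [nbhd]
    simp [this]
  obtain ⟨A, -, hA⟩ := Finite.exists_le_maximal hP0
  obtain ⟨⟨hAX, hAα, hAq⟩, hmax⟩ := hA
  obtain ⟨v, hvX, hvA⟩ : ∃ v ∈ X, v ∉ A := by
    by_contra! hcon
    have := cast_ncard_le (show X ⊆ A from hcon)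
    linarith
  refine ⟨v, hvX, ?_⟩
  by_contra! hlt
  have hvY : v ∈ X \ A := ⟨hvX, hvA⟩
  have hltY : ((ball G (X \ A) v r).ncard : ℝ) < α :=
    (cast_ncard_le (ball_mono_set Set.sdiff_subset)).trans_lt hlt
  -- Growth by a factor `q` at each of the `r` steps would already give `q ^ r ≥ α` vertices.
  obtain ⟨i, hir, hi⟩ : ∃ i < r,
      ((ball G (X \ A) v (i + 1)).ncard : ℝ) < q * (ball G (X \ A) v i).ncard := by
    by_contra! hcon
    have : ∀ i ≤ r, q ^ i ≤ ((ball G (X \ A) v i).ncard : ℝ) := by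
      intro i
      induction i with
      | zero => simp [ball]
      | succ i ih =>
        intro hi
        have h1 := hcon i (by omega)
        have h2 := ih (by omega)
        rw [pow_succ']
        exact (mul_le_mul_of_nonneg_left h2 hq0.le).trans h1
    linarith [this r le_rfl]
  set S := ball G (X \ A) v i with hS
  have hSY : S ⊆ X \ A := ball_subset hvY
  have hSα : (S.ncard : ℝ) < α := (cast_ncard_le (ball_mono hir.le)).trans_lt hltY
  have hdisj : Disjoint A S := Set.disjoint_left.2 fun x hx hxS => (hSY hxS).2 hx
  have hcard : ((A ∪ S).ncard : ℝ) = A.ncard + S.ncard := by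
    exact_mod_cast Set.ncard_union_eq hdisj
  have hAS : A ∪ S ⊆ X := Set.union_subset hAX (hSY.trans Set.sdiff_subset)
  have hT : (((A ∪ S) ∪ X ∩ nbhd G (A ∪ S)).ncard : ℝ) ≤ q * (A ∪ S).ncard := by
    have hsub : (A ∪ S) ∪ X ∩ nbhd G (A ∪ S) ⊆
        (A ∪ X ∩ nbhd G A) ∪ ball G (X \ A) v (i + 1) := by
      rintro x ((hx | hx) | ⟨hxX, y, hy | hy, hyx⟩)
      · exact Or.inl (Or.inl hx)
      · exact Or.inr (Or.inl hx)
      · exact Or.inl (Or.inr ⟨hxX, y, hy, hyx⟩)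
      · by_cases hxA : x ∈ A
        · exact Or.inl (Or.inl hxA)
        · exact Or.inr (Or.inr ⟨⟨hxX, hxA⟩, y, hy, hyx⟩)
    have h1 := (cast_ncard_le hsub).trans (cast_ncard_union_le _ _)
    rw [hcard, mul_add]
    linarith
  -- By maximality `A ∪ S` has at least `α` vertices, yet fewer than `2α`. Its closed neighbourhood
  -- in `X` then has at most `2αq = 2e` vertices, and coherence leaves fewer than `e` others,
  -- contradicting `|X| ≥ 3e`.
  by_cases hbig : ((A ∪ S).ncard : ℝ) < α
  · exact hvA (hmax ⟨hAS, hbig, hT⟩ Set.subset_union_left (Or.inr mem_ball_self))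
  · push Not at hbig
    have hB := h.coh (A ∪ S) (X \ ((A ∪ S) ∪ X ∩ nbhd G (A ∪ S)))
      (Set.disjoint_left.2 fun x hx hx' => hx'.2 (Or.inl hx))
      (fun a ha b hb hab => hb.2 (Or.inr ⟨hb.1, a, ha, hab⟩)) hbig
    have h1 := cast_ncard_le_diff_add X ((A ∪ S) ∪ X ∩ nbhd G (A ∪ S))
    have h2 := cast_ncard_le (Set.inter_subset_left
      (s := (A ∪ S) ∪ X ∩ nbhd G (A ∪ S)) (t := X))
    have h3 : q * ((A ∪ S).ncard : ℝ) ≤ q * (2 * α) :=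
      mul_le_mul_of_nonneg_left (by linarith) hq0.le
    linarith

theorem SparseCoherent.nbhd_le (h : SparseCoherent G α e) (H Y : Set V) (x : V) :
    ((nbhd G H ∩ Y).ncard : ℝ) ≤ (nbhd G (H \ {x}) ∩ Y).ncard + e := by
  have hsub : nbhd G H ∩ Y ⊆ (nbhd G (H \ {x}) ∩ Y) ∪ G.neighborSet x := by
    rintro z ⟨⟨y, hy, hyz⟩, hz⟩
    by_cases hyx : y = x
    · exact Or.inr (hyx ▸ hyz)
    · exact Or.inl ⟨⟨y, ⟨hy, hyx⟩, hyz⟩, hz⟩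
  have := (cast_ncard_le hsub).trans (cast_ncard_union_le _ _)
  linarith [h.deg x]

/-- In a large set `X` one can grow a connected set of small radius until it covers half of one of
given disjoint sets. -/
theorem SparseCoherent.exists_half_cover (h : SparseCoherent G α e) (hα : 0 < α) (hαe : α ≤ e)
    (hq : α * q = e) (hr : α ≤ q ^ r) {X : Set V} (hX : 3 * e ≤ X.ncard)
    {ι : Type*} (J : Finset ι) (hJ : J.Nonempty) (Y : ι → Set V)
    (hXY : ∀ j ∈ J, Disjoint X (Y j)) (hY : ∀ j ∈ J, 2 * e ≤ (Y j).ncard) :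
    ∃ H ⊆ X, (∃ v ∈ H, H ⊆ ball G H v r) ∧
      (∃ j ∈ J, ((Y j).ncard : ℝ) / 2 ≤ (nbhd G H ∩ Y j).ncard) ∧
      ∀ l ∈ J, ((nbhd G H ∩ Y l).ncard : ℝ) ≤ (Y l).ncard / 2 + e := by
  obtain ⟨v, hv, hball⟩ := h.exists_large_ball hα hαe hq hr hX
  let P : Set V → Prop := fun H => ∃ j ∈ J, ((Y j).ncard : ℝ) / 2 ≤ (nbhd G H ∩ Y j).ncard
  have hP0 : ¬ P ∅ := by
    rintro ⟨j, hj, hle⟩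
    have : nbhd G (∅ : Set V) = ∅ := by ext; simp [nbhd]
    simp only [this, Set.empty_inter, Set.ncard_empty, Nat.cast_zero] at hle
    linarith [hY j hj]
  have hP : P (ball G X v r) := by
    obtain ⟨j, hj⟩ := hJ
    refine ⟨j, hj, ?_⟩
    have hsub : ball G X v r ⊆ X := ball_subset hv
    have h1 := h.coh (ball G X v r) (Y j \ nbhd G (ball G X v r))
      ((hXY j hj).mono hsub Set.sdiff_subset)
      (fun a ha b hb hab => hb.2 ⟨a, ha, hab⟩) hball
    have h2 := cast_ncard_le_diff_add (Y j) (nbhd G (ball G X v r))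
    linarith [hY j hj]
  obtain ⟨H, hHX, hvH, hHr, hPH, x, -, hx⟩ := exists_critical_subset (G := G) P hP0
    (mem_ball_self (G := G) (H := X) (a := v) (i := r)) (ball_subset_ball_ball le_rfl) hP
  refine ⟨H, hHX.trans (ball_subset hv), ⟨v, hvH, hHr⟩, hPH, fun l hl => ?_⟩
  have h1 : ((nbhd G (H \ {x}) ∩ Y l).ncard : ℝ) < (Y l).ncard / 2 := by
    by_contra! hcon
    exact hx ⟨l, hl, hcon⟩
  linarith [h.nbhd_le H (Y l) x]

end Growth

/-! ### Many anticomplete connected sets covering one common set. -/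

section Merge

variable {V : Type*} {G : SimpleGraph V} {α e q w W : ℝ} {r : ℕ}

/-- A family of pairwise disjoint and anticomplete connected subsets of `Z`, each covering `X`. -/
structure CoveringFamily (G : SimpleGraph V) (Z : Set V) (r : ℕ) (w : ℝ) (X : Set V)
    (F : Set (Set V)) : Prop where
  subset : ∀ H ∈ F, H ⊆ Z
  radius : ∀ H ∈ F, ∃ v ∈ H, H ⊆ ball G H v r
  large : ∀ H ∈ F, w ≤ (nbhd G H ∩ Z).ncard
  covers : ∀ H ∈ F, X ⊆ nbhd G H
  disjoint : ∀ H ∈ F, Disjoint H X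
  pairwise : F.Pairwise fun H H' => Disjoint H H' ∧ Anticomplete G H H'

theorem CoveringFamily.mono {Z X X' : Set V} {F : Set (Set V)}
    (h : CoveringFamily G Z r w X F) (hX : X' ⊆ X) : CoveringFamily G Z r w X' F :=
  ⟨h.subset, h.radius, h.large, fun H hH => hX.trans (h.covers H hH),
    fun H hH => (h.disjoint H hH).mono_right hX, h.pairwise⟩

theorem CoveringFamily.insert {Z X : Set V} {F : Set (Set V)} {H : Set V}
    (h : CoveringFamily G Z r w X F) (hZ : H ⊆ Z) (hr : ∃ v ∈ H, H ⊆ ball G H v r)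
    (hw : w ≤ (nbhd G H ∩ Z).ncard) (hc : X ⊆ nbhd G H) (hd : Disjoint H X)
    (hF : ∀ H' ∈ F, Disjoint H' H ∧ Anticomplete G H' H) :
    CoveringFamily G Z r w X (insert H F) where
  subset := Set.forall_mem_insert.2 ⟨hZ, h.subset⟩
  radius := Set.forall_mem_insert.2 ⟨hr, h.radius⟩
  large := Set.forall_mem_insert.2 ⟨hw, h.large⟩
  covers := Set.forall_mem_insert.2 ⟨hc, h.covers⟩
  disjoint := Set.forall_mem_insert.2 ⟨hd, h.disjoint⟩
  pairwise := h.pairwise.insert fun H' hH' _ =>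
    ⟨⟨(hF H' hH').1.symm, fun a ha b hb hab => (hF H' hH').2 b hb a ha hab.symm⟩, hF H' hH'⟩

/-- Repeatedly sacrificing the part covered by the fewest connected sets, and growing in it a
connected set that covers half of another part, produces a part covered by `n` connected sets. -/
theorem SparseCoherent.exists_coveringFamily_of_parts [Finite V] (h : SparseCoherent G α e)
    (hα : 0 < α) (hαe : α ≤ e) (hq : α * q = e) (hr : α ≤ q ^ r) (hW : 4 * e ≤ W)
    {ι : Type*} [DecidableEq ι] (Z : Set V) (n t : ℕ) (J : Finset ι) (hJ : J.card = t + 1)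
    (X : ι → Set V) (F : ι → Set (Set V)) (hXZ : ∀ j ∈ J, X j ⊆ Z)
    (hdisj : ∀ i ∈ J, ∀ j ∈ J, i ≠ j → Disjoint (X i) (X j))
    (hF : ∀ j ∈ J, CoveringFamily G Z r (2 * W) (X j) (F j))
    (hcross : ∀ i ∈ J, ∀ j ∈ J, i ≠ j → ∀ H ∈ F j, Disjoint H (X i) ∧ Anticomplete G H (X i))
    (hsize : ∀ j ∈ J, 2 ^ (t + 2) * W - 2 * e ≤ (X j).ncard)
    (hsum : 2 ^ n ≤ ∑ j ∈ J, 2 ^ (F j).ncard) :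
    ∃ X F, X ⊆ Z ∧ X.Nonempty ∧ CoveringFamily G Z r (2 * W) X F ∧ n ≤ F.ncard := by
  have he : 0 < e := hα.trans_le hαe
  induction t generalizing J X F with
  | zero =>
    obtain ⟨j, rfl⟩ := Finset.card_eq_one.1 hJ
    have hj := Finset.mem_singleton_self j
    refine ⟨X j, F j, hXZ j hj, ?_, hF j hj, ?_⟩
    · rw [← Set.ncard_pos]
      have := hsize j hj
      have h2 : (0 : ℝ) < (X j).ncard := by norm_num at this; linarith
      exact_mod_cast h2
    · rw [Finset.sum_singleton] at hsum
      exact (Nat.pow_le_pow_iff_right (by norm_num)).1 hsum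
  | succ t ih =>
    have hpow : (4 : ℝ) * W ≤ 2 ^ (t + 2) * W := by
      have : (1 : ℝ) ≤ 2 ^ t := one_le_pow₀ (by norm_num)
      rw [pow_add]
      nlinarith
    have hpow' : (2 : ℝ) ^ (t + 1 + 2) * W = 2 * (2 ^ (t + 2) * W) := by ring
    -- The sum of `2 ^ |F j|` is a potential that must not decrease: losing the smallest term is
    -- repaid when the newly grown set doubles the term of another part.
    obtain ⟨i, hi, hmin⟩ := Finset.exists_min_image J (fun j => (F j).ncard)
      (Finset.card_pos.1 (by omega))
    have hcard : (J.erase i).card = t + 1 := by rw [Finset.card_erase_of_mem hi, hJ]; rfl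
    have hJ' : ∀ {j}, j ∈ J.erase i → j ∈ J := fun hj => Finset.mem_of_mem_erase hj
    have hJi : ∀ {j}, j ∈ J.erase i → i ≠ j := fun hj => (Finset.ne_of_mem_erase hj).symm
    obtain ⟨H, hHX, hHr, ⟨k, hk, hhalf⟩, hle⟩ := h.exists_half_cover hα hαe hq hr
      (X := X i) (by linarith [hsize i hi]) (J.erase i) (Finset.card_pos.1 (by omega)) X
      (fun j hj => hdisj i hi j (hJ' hj) (hJi hj))
      (fun j hj => by linarith [hsize j (hJ' hj)])
    have hHd : ∀ j ∈ J.erase i, Disjoint H (X j) := fun j hj =>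
      (hdisj i hi j (hJ' hj) (hJi hj)).mono_left hHX
    have hold : ∀ j ∈ J.erase i, ∀ H' ∈ F j, Disjoint H' H ∧ Anticomplete G H' H :=
      fun j hj H' hH' =>
        have := hcross i hi j (hJ' hj) (hJi hj) H' hH'
        ⟨this.1.mono_right hHX, fun a ha b hb => this.2 a ha b (hHX hb)⟩
    have hHF : H ∉ F k := fun hmem => by
      obtain ⟨v, hv, -⟩ := hHr
      exact Set.disjoint_left.1 (hold k hk H hmem).1 hv hv
    -- The part `k` keeps what `H` covers. The others keep what `H` misses, which makes `H`
    -- anticomplete to them.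
    let X' : ι → Set V := fun j => if j = k then nbhd G H ∩ X j else X j \ nbhd G H
    let F' : ι → Set (Set V) := fun j => if j = k then insert H (F j) else F j
    have hX'X : ∀ j, X' j ⊆ X j := by
      intro j
      by_cases hjk : j = k
      · simp only [X', if_pos hjk]; exact Set.inter_subset_right
      · simp only [X', if_neg hjk]; exact Set.sdiff_subset
    refine ih (J.erase i) hcard X' F' (fun j hj => (hX'X j).trans (hXZ j (hJ' hj)))
      (fun a ha b hb hab =>
        (hdisj a (hJ' ha) b (hJ' hb) hab).mono (hX'X a) (hX'X b)) ?_ ?_ ?_ ?_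
    · intro j hj
      have hmono := (hF j (hJ' hj)).mono (hX'X j)
      by_cases hjk : j = k
      · subst hjk
        have hF' : F' j = insert H (F j) := if_pos rfl
        rw [hF']
        refine hmono.insert (hHX.trans (hXZ i hi)) hHr ?_ ?_ ((hHd j hj).mono_right (hX'X j))
          (hold j hj)
        · have h1 := cast_ncard_le
            (Set.inter_subset_inter_right (nbhd G H) (hXZ j (hJ' hj)))
          linarith [hsize j (hJ' hj)]
        · simp only [X', if_true]; exact Set.inter_subset_left
      · have hF' : F' j = F j := if_neg hjk
        rwa [hF']
    · intro a ha b hb hab H' hH'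
      have hFb : ∀ H' ∈ F b, Disjoint H' (X' a) ∧ Anticomplete G H' (X' a) := fun H' hH' =>
        have := hcross a (hJ' ha) b (hJ' hb) hab H' hH'
        ⟨this.1.mono_right (hX'X a), fun x hx y hy => this.2 x hx y (hX'X a hy)⟩
      by_cases hbk : b = k
      · subst hbk
        simp only [F', if_true] at hH'
        rcases hH' with rfl | hH'
        · refine ⟨(hHd a ha).mono_right (hX'X a), fun x hx y hy hxy => ?_⟩
          simp only [X', if_neg hab] at hy
          exact hy.2 ⟨x, hx, hxy⟩
        · exact hFb H' hH'
      · simp only [F', if_neg hbk] at hH'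
        exact hFb H' hH'
    -- A part of size `s` retains at least `s/2 - e`; the term `-2e` in the size bound is the fixed
    -- point of this recursion.
    · intro j hj
      have hj' := hsize j (hJ' hj)
      by_cases hjk : j = k
      · subst hjk
        simp only [X', if_true]
        linarith
      · simp only [X', if_neg hjk]
        have h1 := cast_ncard_le_diff_add (X j) (nbhd G H)
        linarith [hle j hj]
    · refine hsum.trans ?_
      have hik := hmin k (hJ' hk)
      have hkc : (F' k).ncard = (F k).ncard + 1 := by
        simp only [F', if_true]
        exact Set.ncard_insert_of_notMem hHF
      rw [← Finset.add_sum_erase J _ hi, ← Finset.add_sum_erase (J.erase i) _ hk,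
        ← Finset.add_sum_erase (J.erase i) (fun j => 2 ^ (F' j).ncard) hk, hkc, pow_succ]
      have hrest : ∑ j ∈ (J.erase i).erase k, 2 ^ (F' j).ncard =
          ∑ j ∈ (J.erase i).erase k, 2 ^ (F j).ncard :=
        Finset.sum_congr rfl fun j hj => by
          simp only [F', if_neg (Finset.ne_of_mem_erase hj)]
      have := Nat.pow_le_pow_right (n := 2) (by norm_num) hik
      rw [hrest]
      omega

theorem exists_disjoint_parts (Z : Set V) (s t : ℕ) (hZ : s * t ≤ Z.ncard) :
    ∃ X : Fin s → Set V, (∀ j, X j ⊆ Z) ∧ (∀ i j, i ≠ j → Disjoint (X i) (X j)) ∧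
      ∀ j, (X j).ncard = t := by
  obtain ⟨Y, hYZ, hY⟩ := Set.exists_subset_card_eq hZ
  rcases Nat.eq_zero_or_pos (s * t) with h0 | hpos
  · refine ⟨fun _ => ∅, fun _ => Set.empty_subset _, fun _ _ _ => by simp, fun j => ?_⟩
    rcases Nat.mul_eq_zero.1 h0 with rfl | rfl
    · exact j.elim0
    · simp
  have hfin : Finite Y := Set.finite_of_ncard_pos (hY ▸ hpos)
  have hcard : Nat.card (Fin s × Fin t) = Nat.card Y := by
    rw [Nat.card_coe_set_eq, hY]; simp
  obtain ⟨f⟩ := Finite.card_eq.1 hcard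
  have hinj : ∀ j, Function.Injective fun i => ((f (j, i) : Y) : V) := fun j a b hab => by
    have := f.injective (Subtype.ext hab)
    exact (Prod.ext_iff.1 this).2
  refine ⟨fun j => Set.range fun i => ((f (j, i) : Y) : V), ?_, ?_, fun j => ?_⟩
  · rintro j _ ⟨i, rfl⟩
    exact hYZ (f (j, i)).2
  · refine fun i j hij => Set.disjoint_left.2 ?_
    rintro _ ⟨a, rfl⟩ ⟨b, hb⟩
    have := f.injective (Subtype.ext hb)
    exact hij (Prod.ext_iff.1 this).1.symm
  · change (Set.range fun i => ((f (j, i) : Y) : V)).ncard = t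
    rw [← Set.image_univ, Set.ncard_image_of_injective _ (hinj j)]
    simp

theorem add_two_pow_le_two_pow_two_mul {n : ℕ} (hn : 1 ≤ n) : n + (2 ^ n + 1) ≤ 2 ^ (2 * n) := by
  induction n, hn using Nat.le_induction with
  | base => norm_num
  | succ n hn ih =>
    rw [show 2 * (n + 1) = 2 * n + 2 by ring, pow_add 2 (2 * n), pow_succ 2 n]
    omega

/-- With `2 ^ n` parts and empty families the potential starts at `2 ^ n`, so the last surviving
part has at least `n` covering sets. The parts halve about `2 ^ n` times, whence the double
exponential. -/
theorem SparseCoherent.exists_coveringFamily [Finite V] (h : SparseCoherent G α e)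
    (hα : 0 < α) (hαe : α ≤ e) (hq : α * q = e) (hr : α ≤ q ^ r) (hW : 4 * e ≤ W) (he : 1 ≤ e)
    (Z : Set V) {n : ℕ} (hn : 1 ≤ n) (hZ : 2 ^ 2 ^ (2 * n) * W ≤ Z.ncard) :
    ∃ X F, X ⊆ Z ∧ X.Nonempty ∧ CoveringFamily G Z r (2 * W) X F ∧ n ≤ F.ncard := by
  set b : ℝ := 2 ^ (2 ^ n + 1) * W - 2 * e with hb
  have hpow : (1 : ℝ) ≤ 2 ^ (2 ^ n + 1) := one_le_pow₀ (by norm_num)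
  have hb0 : 0 ≤ b := by nlinarith
  have hceil := Nat.ceil_lt_add_one hb0
  obtain ⟨X, hXZ, hX, hXb⟩ := exists_disjoint_parts Z (2 ^ n) ⌈b⌉₊ (by
    have h1 : ((2 ^ n * ⌈b⌉₊ : ℕ) : ℝ) ≤ Z.ncard := by
      push_cast
      calc (2 : ℝ) ^ n * ⌈b⌉₊ ≤ 2 ^ n * (2 ^ (2 ^ n + 1) * W) := by
            gcongr
            linarith
        _ = 2 ^ (n + (2 ^ n + 1)) * W := by rw [pow_add 2 n]; ring
        _ ≤ 2 ^ 2 ^ (2 * n) * W := by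
            have := add_two_pow_le_two_pow_two_mul hn
            gcongr
            · linarith
            · norm_num
        _ ≤ Z.ncard := hZ
    exact_mod_cast h1)
  obtain ⟨t, ht⟩ : ∃ t, 2 ^ n = t + 1 := ⟨2 ^ n - 1, (Nat.sub_add_cancel Nat.one_le_two_pow).symm⟩
  refine h.exists_coveringFamily_of_parts hα hαe hq hr hW Z n t Finset.univ (by simpa using ht) X
    (fun _ => ∅) (fun j _ => hXZ j) (fun i _ j _ => hX i j) (fun j _ => ?_) (by simp) ?_ (by simp)
  · constructor <;> simp
  · intro j _
    rw [hXb, show t + 2 = 2 ^ n + 1 by omega]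
    exact Nat.le_ceil b

end Merge

/-! ### Skeletons with a common apex, and their separation. -/

section Skeleton

variable {V : Type*} {G : SimpleGraph V} {α e q W : ℝ} {r n ρ : ℕ}

/-- Sets of radius at most `ρ` about a common vertex `a` that are disjoint and anticomplete apart
from `a`. -/
structure IsSkeleton (G : SimpleGraph V) (ρ : ℕ) (a : V) (K : Fin n → Set V) : Prop where
  apex_mem : ∀ p, a ∈ K p
  radius : ∀ p, K p ⊆ ball G (K p) a ρ
  disjoint : ∀ p p', p ≠ p' → Disjoint (K p \ {a}) (K p' \ {a})
  anticomplete : ∀ p p', p ≠ p' → Anticomplete G (K p \ {a}) (K p' \ {a})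

/-- The closed neighbourhood of `H`. -/
def closedNbhd (G : SimpleGraph V) (H : Set V) : Set V := H ∪ nbhd G H

theorem SparseCoherent.closedNbhd_le [Finite V] (h : SparseCoherent G α e) (H Z : Set V) (x : V) :
    ((closedNbhd G H ∩ Z).ncard : ℝ) ≤ (closedNbhd G (H \ {x}) ∩ Z).ncard + (e + 1) := by
  have hsub : closedNbhd G H ∩ Z ⊆
      (closedNbhd G (H \ {x}) ∩ Z) ∪ (G.neighborSet x ∪ {x}) := by
    rintro z ⟨hz | ⟨y, hy, hyz⟩, hzZ⟩
    · by_cases hzx : z = x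
      · exact Or.inr (Or.inr hzx)
      · exact Or.inl ⟨Or.inl ⟨hz, hzx⟩, hzZ⟩
    · by_cases hyx : y = x
      · exact Or.inr (Or.inl (hyx ▸ hyz))
      · exact Or.inl ⟨Or.inr ⟨y, ⟨hy, hyx⟩, hyz⟩, hzZ⟩
  have h1 := (cast_ncard_le hsub).trans (cast_ncard_union_le _ _)
  have h2 := cast_ncard_union_le (G.neighborSet x) {x}
  rw [Set.ncard_singleton, Nat.cast_one] at h2
  linarith [h.deg x]

/-- The apex is any vertex of the commonly covered set. Pruning each member until its closed
neighbourhood barely reaches `2 * W` bounds both that neighbourhood and, through coherence, the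
member itself. -/
theorem SparseCoherent.exists_isSkeleton [Finite V] (h : SparseCoherent G α e)
    (hα : 0 < α) (hαe : α ≤ e) (hq : α * q = e) (hr : α ≤ q ^ r) (hW : 4 * e ≤ W) (he : 1 ≤ e)
    (Z : Set V) (hn : 1 ≤ n) (hZ : 2 ^ 2 ^ (2 * n) * W ≤ Z.ncard) :
    ∃ (a : V) (K : Fin n → Set V), IsSkeleton G (2 * r + 1) a K ∧ ∀ p, K p ⊆ Z ∧
      (K p).ncard ≤ 2 * e ∧ 2 * W ≤ (closedNbhd G (K p) ∩ Z).ncard ∧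
      (closedNbhd G (K p) ∩ Z).ncard ≤ 3 * W := by
  obtain ⟨X, F, hXZ, ⟨a, ha⟩, hF, hnF⟩ := h.exists_coveringFamily hα hαe hq hr hW he Z hn hZ
  obtain ⟨H, hHF, hHinj⟩ : ∃ H : Fin n → Set V, (∀ p, H p ∈ F) ∧ Function.Injective H := by
    have : Fintype F := Fintype.ofFinite F
    obtain ⟨f⟩ := Function.Embedding.nonempty_of_card_le (α := Fin n) (β := F) (by
      rw [Fintype.card_fin, Fintype.card_eq_nat_card, Nat.card_coe_set_eq]; exact hnF)
    exact ⟨fun p => f p, fun p => (f p).2, Subtype.val_injective.comp f.injective⟩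
  have hWZ : 8 * W ≤ Z.ncard := by
    have h2 : (2 : ℝ) ^ 3 ≤ 2 ^ 2 ^ (2 * n) := by
      refine pow_le_pow_right₀ (by norm_num) ?_
      calc 3 ≤ 2 ^ 2 := by norm_num
        _ ≤ 2 ^ (2 * n) := Nat.pow_le_pow_right (by norm_num) (by omega)
    nlinarith
  have hprune : ∀ p, ∃ K ⊆ insert a (H p), a ∈ K ∧ K ⊆ ball G K a (2 * r + 1) ∧
      2 * W ≤ (closedNbhd G K ∩ Z).ncard ∧
      ∃ x ∈ K, ¬ 2 * W ≤ ((closedNbhd G (K \ {x}) ∩ Z).ncard : ℝ) := by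
    intro p
    obtain ⟨v, hv, hvr⟩ := hF.radius _ (hHF p)
    obtain ⟨x, hx, hxa⟩ := hF.covers _ (hHF p) ha
    refine exists_critical_subset
      (P := fun K => 2 * W ≤ ((closedNbhd G K ∩ Z).ncard : ℝ)) ?_ (Set.mem_insert a (H p))
      (insert_subset_ball hv hvr hx hxa.symm) ?_
    · have : closedNbhd G (∅ : Set V) ∩ Z = ∅ := by ext; simp [closedNbhd, nbhd]
      simp only [this, Set.ncard_empty, Nat.cast_zero]
      linarith
    · refine (hF.large _ (hHF p)).trans (cast_ncard_le (Set.inter_subset_inter_left Z ?_))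
      exact (nbhd_mono (Set.subset_insert _ _)).trans Set.subset_union_right
  choose K hKH haK hKr hK2 x hx hxK using hprune
  have hKa : ∀ p, K p \ {a} ⊆ H p := fun p y hy => (hKH p hy.1).resolve_left hy.2
  refine ⟨a, K, ⟨haK, hKr, fun p p' hp => ?_, fun p p' hp => ?_⟩, fun p => ⟨?_, ?_, hK2 p, ?_⟩⟩
  · exact (hF.pairwise (hHF p) (hHF p') (hHinj.ne hp)).1.mono (hKa p) (hKa p')
  · exact fun y hy z hz =>
      (hF.pairwise (hHF p) (hHF p') (hHinj.ne hp)).2 y (hKa p hy) z (hKa p' hz)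
  · exact (hKH p).trans (Set.insert_subset (hXZ ha) (hF.subset _ (hHF p)))
  -- Otherwise coherence would let `K p \ {x p}` miss fewer than `e` vertices of `Z`; but it misses
  -- more than `8W - 2W`.
  · have hsmall : ((K p \ {x p}).ncard : ℝ) < α := by
      by_contra! hcon
      have h1 := h.coh (K p \ {x p}) (Z \ closedNbhd G (K p \ {x p}))
        (Set.disjoint_left.2 fun y hy hy' => hy'.2 (Or.inl hy))
        (fun y hy z hz hyz => hz.2 (Or.inr ⟨y, hy, hyz⟩)) hcon
      have h2 := cast_ncard_le_diff_add Z (closedNbhd G (K p \ {x p}))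
      linarith [hxK p]
    have h1 : ((K p).ncard : ℝ) = (K p \ {x p}).ncard + 1 := by
      exact_mod_cast (Set.ncard_sdiff_singleton_add_one (hx p)).symm
    linarith
  · linarith [hxK p, h.closedNbhd_le (K p) Z (x p)]

/-- Many skeletons that are pairwise disjoint and anticomplete, with large sets `E i p` in the
closed neighbourhoods of their members that avoid the other skeletons. -/
theorem SparseCoherent.exists_skeletons [Finite V] (h : SparseCoherent G α e)
    (hα : 0 < α) (hαe : α ≤ e) (hq : α * q = e) (hr : α ≤ q ^ r) (hW : 4 * e ≤ W) (he : 1 ≤ e)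
    (hn : 1 ≤ n) (m : ℕ) (Z : Set V)
    (hZ : (2 ^ 2 ^ (2 * n) + 3 * ((m : ℝ) - 1) * n) * W ≤ Z.ncard) :
    ∃ (a : Fin m → V) (K E : Fin m → Fin n → Set V),
      (∀ i, IsSkeleton G (2 * r + 1) (a i) (K i)) ∧
      (∀ i p, K i p ⊆ Z ∧ E i p ⊆ Z ∧ (K i p).ncard ≤ 2 * e ∧ E i p ⊆ closedNbhd G (K i p) ∧
        2 * W ≤ (E i p).ncard) ∧
      ∀ i j, i ≠ j → ∀ p p', Disjoint (K i p) (K j p') ∧ Anticomplete G (K i p) (K j p') ∧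
        Disjoint (E i p) (K j p') := by
  induction m generalizing Z with
  | zero => exact ⟨Fin.elim0, Fin.elim0, Fin.elim0, fun i => i.elim0, fun i => i.elim0,
      fun i => i.elim0⟩
  | succ m ih =>
    push_cast at hZ
    have hWpos : 0 < W := by linarith
    have hmn : (0 : ℝ) ≤ 3 * m * n * W := by positivity
    obtain ⟨a₀, K₀, hskel, hK₀⟩ := h.exists_isSkeleton hα hαe hq hr hW he Z hn (by nlinarith)
    -- Whatever is built outside `U` is disjoint from and anticomplete to this skeleton. The cost
    -- `3nW` per skeleton is the source of the term `3(m-1)n`.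
    set U : Set V := ⋃ p, closedNbhd G (K₀ p) ∩ Z with hU
    have hUcard : (U.ncard : ℝ) ≤ n * (3 * W) := by
      have h1 : U.ncard ≤ ∑ p, (closedNbhd G (K₀ p) ∩ Z).ncard := by
        exact Set.ncard_iUnion_le_of_fintype _
      calc (U.ncard : ℝ) ≤ ∑ p, ((closedNbhd G (K₀ p) ∩ Z).ncard : ℝ) := by exact_mod_cast h1
        _ ≤ ∑ p : Fin n, 3 * W := Finset.sum_le_sum fun p _ => (hK₀ p).2.2.2
        _ = n * (3 * W) := by simp
    obtain ⟨a, K, E, hsk, hKE, hcross⟩ := ih (Z \ U) (by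
      have h1 := cast_ncard_le_diff_add Z U
      have h2 := cast_ncard_le (Set.inter_subset_left (s := U) (t := Z))
      nlinarith)
    have hnot : ∀ p, ∀ x ∈ Z \ U, x ∉ closedNbhd G (K₀ p) := fun p x hx hxp =>
      hx.2 (Set.mem_iUnion.2 ⟨p, hxp, hx.1⟩)
    refine ⟨Fin.cons a₀ a, Fin.cons K₀ K, Fin.cons (fun p => closedNbhd G (K₀ p) ∩ Z) E,
      Fin.cases ?_ ?_, Fin.cases ?_ ?_, Fin.cases (Fin.cases ?_ ?_) fun i => Fin.cases ?_ ?_⟩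
    · simpa using hskel
    · simpa using hsk
    · intro p
      simp only [Fin.cons_zero]
      exact ⟨(hK₀ p).1, Set.inter_subset_right, (hK₀ p).2.1, Set.inter_subset_left,
        (hK₀ p).2.2.1⟩
    · intro i p
      simp only [Fin.cons_succ]
      obtain ⟨h1, h2, h3⟩ := hKE i p
      exact ⟨h1.trans Set.sdiff_subset, h2.trans Set.sdiff_subset, h3⟩
    · exact fun h => absurd rfl h
    · intro j _ p p'
      simp only [Fin.cons_zero, Fin.cons_succ]
      have hj := (hKE j p').1
      exact ⟨Set.disjoint_left.2 fun x hx hx' => hnot p x (hj hx') (Or.inl hx),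
        fun x hx y hy hxy => hnot p y (hj hy) (Or.inr ⟨x, hx, hxy⟩),
        Set.disjoint_left.2 fun x hx hx' => hnot p x (hj hx') hx.1⟩
    · intro _ p p'
      simp only [Fin.cons_zero, Fin.cons_succ]
      obtain ⟨hi, hE, -⟩ := hKE i p
      exact ⟨Set.disjoint_left.2 fun x hx hx' => hnot p' x (hi hx) (Or.inl hx'),
        fun x hx y hy hxy => hnot p' x (hi hx) (Or.inr ⟨y, hy, hxy.symm⟩),
        Set.disjoint_left.2 fun x hx hx' => hnot p' x (hE hx) (Or.inl hx')⟩
    · intro j hij p p'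
      simp only [Fin.cons_succ]
      exact hcross i j (fun h => hij (congrArg Fin.succ h)) p p'

end Skeleton

/-! ### From skeletons to a troupe by pigeonhole. -/

section Troupe

variable {V : Type*} {G : SimpleGraph V} {K B : Set V} {a x : V} {n m ρ h i : ℕ} {e : ℝ}

/-- The vertices at distance exactly `i` from `a` in the subgraph induced on `K ∪ {a}`. -/
def layer (G : SimpleGraph V) (K : Set V) (a : V) (i : ℕ) : Set V :=
  {x | x ∈ ball G K a i ∧ ∀ j < i, x ∉ ball G K a j}

theorem layer_covers (i : ℕ) : Covers G (layer G K a i) (layer G K a (i + 1)) := by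
  rintro x ⟨hx, hx'⟩
  rcases mem_ball_succ.1 hx with hx | ⟨hxK, y, hy, hyx⟩
  · exact absurd hx (hx' i (Nat.lt_succ_self i))
  · exact ⟨y, ⟨hy, fun j hj hyj => hx' (j + 1) (by omega) (Or.inr ⟨hxK, y, hyj, hyx⟩)⟩, hyx⟩

/-- The levelling formed by the layers of `K` up to `h`, followed by a set `B` of vertices whose
nearest neighbours in `K` are in layer `h`. -/
theorem exists_levelling (ha : a ∈ K) (hBK : Disjoint B K) (hB : B ⊆ nbhd G (ball G K a h))
    (hB' : ∀ x ∈ B, ∀ i < h, x ∉ nbhd G (ball G K a i)) :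
    ∃ L : Levelling G, L.height = h + 1 ∧ L.apex = a ∧ L.base = B ∧ L.heart ⊆ K ∧
      L.vertexSet ⊆ K ∪ B ∧ (∀ x ∈ L.heart, x ∉ L.penultimate → ∃ i < h, x ∈ ball G K a i) ∧
      ∀ x ∈ L.inner, ∃ i < h, x ∈ ball G K a i := by
  classical
  let lev : ℕ → Set V := fun i => if i ≤ h then layer G K a i else if i = h + 1 then B else ∅
  have lev_le : ∀ {i}, i ≤ h → lev i = layer G K a i := fun hi => if_pos hi
  have lev_eq : lev (h + 1) = B := by simp [lev]
  have lev_gt : ∀ {i}, h + 1 < i → lev i = ∅ := fun {i} hi => by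
    simp only [lev]; rw [if_neg (by omega), if_neg (by omega)]
  have layerK : ∀ i, layer G K a i ⊆ K := fun i x hx => ball_subset ha hx.1
  have hdisj : ∀ i j, i < j → Disjoint (lev i) (lev j) := by
    intro i j hij
    rcases lt_trichotomy j (h + 1) with hj | rfl | hj
    · rw [lev_le (by omega), lev_le (by omega)]
      exact Set.disjoint_left.2 fun x hx hx' => hx'.2 i hij hx.1
    · rw [lev_le (by omega), lev_eq]
      exact (hBK.mono_right (layerK i)).symm
    · rw [lev_gt hj]; exact Set.disjoint_empty _
  let L : Levelling G :=
    { height := h + 1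
      one_le_height := by omega
      apex := a
      level := lev
      level_of_height_lt := fun i hi => lev_gt hi
      level_zero := by
        rw [lev_le (Nat.zero_le h)]
        ext x
        simp [layer, ball]
      level_disjoint := fun i j hij =>
        (lt_or_gt_of_ne hij).elim (hdisj i j) fun hji => (hdisj j i hji).symm
      level_covers := fun i hi => by
        rcases Nat.lt_or_ge i h with hlt | hge
        · rw [lev_le hlt.le, lev_le hlt]
          exact layer_covers i
        · obtain rfl : i = h := by omega
          rw [lev_le le_rfl, lev_eq]
          intro x hx
          obtain ⟨y, hy, hyx⟩ := hB hx
          exact ⟨y, ⟨hy, fun j hj hyj => hB' x hx j hj ⟨y, hyj, hyx⟩⟩, hyx⟩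
      level_anticomplete := fun i j hij hj => by
        rw [lev_le (by omega)]
        rcases Nat.lt_or_ge h j with hlt | hge
        · obtain rfl : j = h + 1 := by omega
          rw [lev_eq]
          exact fun y hy x hx hyx => hB' x hx i (by omega) ⟨y, hy.1, hyx⟩
        · rw [lev_le hge]
          exact fun y hy x hx hyx =>
            hx.2 (i + 1) (by omega) (Or.inr ⟨layerK j hx, y, hy.1, hyx⟩) }
  have hbase : L.base = B := lev_eq
  have hvert : ∀ x ∈ L.vertexSet, x ∈ B ∨ ∃ i ≤ h, x ∈ layer G K a i := by
    rintro x ⟨i, hi, hx⟩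
    rcases Nat.lt_or_ge h i with hlt | hge
    · obtain rfl : i = h + 1 := le_antisymm hi hlt
      exact Or.inl (lev_eq ▸ hx)
    · exact Or.inr ⟨i, hge, lev_le hge ▸ hx⟩
  have hheart : ∀ x ∈ L.heart, ∃ i ≤ h, x ∈ layer G K a i := fun x hx =>
    (hvert x hx.1).resolve_left (hbase ▸ hx.2)
  refine ⟨L, rfl, rfl, hbase, ?_, ?_, ?_, ?_⟩
  · intro x hx
    obtain ⟨i, -, hi⟩ := hheart x hx
    exact layerK i hi
  · intro x hx
    rcases hvert x hx with hB | ⟨i, -, hi⟩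
    · exact Or.inr hB
    · exact Or.inl (layerK i hi)
  · intro x hx hxp
    obtain ⟨i, hi, hxi⟩ := hheart x hx
    rcases hi.lt_or_eq with hlt | rfl
    · exact ⟨i, hlt, hxi.1⟩
    · refine absurd ?_ hxp
      change x ∈ lev (i + 1 - 1)
      rwa [Nat.add_sub_cancel, lev_le le_rfl]
  · rintro x ⟨i, hi, hx⟩
    have hi' : i + 2 ≤ h + 1 := hi
    have hx' : x ∈ lev i := hx
    rw [lev_le (by omega)] at hx'
    exact ⟨i, by omega, hx'.1⟩

/-- The distance from `a` to the nearest neighbour of `x` in `K`, or `ρ + 1` if this distance is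
larger. -/
noncomputable def attachDist (G : SimpleGraph V) (K : Set V) (a : V) (ρ : ℕ) (x : V) : ℕ :=
  sInf {i | x ∈ nbhd G (ball G K a i) ∨ i = ρ + 1}

theorem attachDist_le : attachDist G K a ρ x ≤ ρ + 1 := Nat.sInf_le (Or.inr rfl)

theorem attachDist_le_of_mem (hx : x ∈ nbhd G (ball G K a i)) : attachDist G K a ρ x ≤ i :=
  Nat.sInf_le (Or.inl hx)

theorem mem_nbhd_of_attachDist_le (hx : attachDist G K a ρ x ≤ ρ) :
    x ∈ nbhd G (ball G K a (attachDist G K a ρ x)) :=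
  (Nat.sInf_mem (s := {i | x ∈ nbhd G (ball G K a i) ∨ i = ρ + 1}) ⟨_, Or.inr rfl⟩).resolve_right
    (show attachDist G K a ρ x ≠ ρ + 1 by omega)

theorem exists_large_fiber [Finite V] {ι : Type*} [Fintype ι] [Nonempty ι] (f : V → ι)
    (D : Set V) (hD : Fintype.card ι * e ≤ D.ncard) :
    ∃ c, e ≤ (D ∩ f ⁻¹' {c}).ncard := by
  classical
  have hfin := Set.toFinite D
  obtain ⟨c, -, hc⟩ := Finset.exists_le_card_fiber_of_nsmul_le_card_of_maps_to
    (s := hfin.toFinset) (t := Finset.univ) (f := f) (b := e) (fun _ _ => Finset.mem_univ _)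
    Finset.univ_nonempty (by
      rw [Finset.card_univ, nsmul_eq_mul, ← Set.ncard_eq_toFinset_card D hfin]; exact hD)
  refine ⟨c, hc.trans_eq ?_⟩
  rw [← Set.ncard_coe_finset]
  congr 2
  ext x
  simp

/-- Skeletons that are pairwise disjoint and anticomplete, whose members have many neighbours
elsewhere, give rise to a troupe. -/
theorem exists_troupe [Finite V] (he : 0 < e) (hn : 1 ≤ n) (a : Fin m → V)
    (K D : Fin m → Fin n → Set V) (hK : ∀ i, IsSkeleton G ρ (a i) (K i))
    (hcross : ∀ i j, i ≠ j → ∀ p p', Disjoint (K i p) (K j p') ∧ Anticomplete G (K i p) (K j p'))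
    (hDK : ∀ i p j p', Disjoint (D i p) (K j p'))
    (hD : ∀ i p, D i p ⊆ nbhd G (K i p))
    (hsize : ∀ i p, ((ρ : ℝ) + 2) ^ (m * n) * e ≤ (D i p).ncard) :
    ∃ T : Fin m → Lobster G n, IsTroupe T ∧
      ∀ i, (T i).height ≤ ρ + 1 ∧ e ≤ (T i).mass := by
  -- The profile of a vertex: its attachment distance to each of the `mn` members, hence at most `(ρ
  -- + 2) ^ (m * n)` profiles.
  let f : V → (Fin m × Fin n → Fin (ρ + 2)) := fun x s =>
    ⟨attachDist G (K s.1 s.2) (a s.1) ρ x, Nat.lt_succ_of_le attachDist_le⟩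
  have hfib : ∀ s : Fin m × Fin n, ∃ c, e ≤ (D s.1 s.2 ∩ f ⁻¹' {c}).ncard := fun s =>
    exists_large_fiber f _ (by simpa using hsize s.1 s.2)
  choose c hc using hfib
  set C : Fin m × Fin n → Set V := fun s => D s.1 s.2 ∩ f ⁻¹' {c s} with hC
  have hCdist : ∀ s t, ∀ x ∈ C s, attachDist G (K t.1 t.2) (a t.1) ρ x = c s t := by
    rintro s t x ⟨-, hx⟩
    rw [← show f x = c s from hx]
  have hCne : ∀ s, (C s).Nonempty := fun s => by
    rw [← Set.ncard_pos]
    exact_mod_cast he.trans_le (hc s)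
  -- The base of member `t` will be `C (σ t)`, not necessarily `C t`. Different members may share a
  -- base.
  have hmin : ∀ t, ∃ s, ∀ s', c s t ≤ c s' t := fun t =>
    have : Nonempty (Fin m × Fin n) := ⟨t⟩
    Finite.exists_min fun s => c s t
  choose σ hσ using hmin
  -- The class `C t` consists of neighbours of member `t`, so the minimum is never the default value
  -- `ρ + 1`.
  have hle : ∀ t, (c (σ t) t : ℕ) ≤ ρ := fun t => by
    refine le_trans (hσ t t) ?_
    obtain ⟨x, hx⟩ := hCne t
    rw [← hCdist t t x hx]
    exact attachDist_le_of_mem (nbhd_mono ((hK t.1).radius t.2) (hD t.1 t.2 hx.1))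
  have hfar : ∀ s t, ∀ x ∈ C s, ∀ i < (c (σ t) t : ℕ),
      x ∉ nbhd G (ball G (K t.1 t.2) (a t.1) i) := by
    intro s t x hx i hi hxi
    have h1 := attachDist_le_of_mem (ρ := ρ) hxi
    rw [hCdist s t x hx] at h1
    have h2 : (c (σ t) t : ℕ) ≤ c s t := hσ t s
    omega
  have hlev : ∀ t : Fin m × Fin n, _ := fun t => exists_levelling (B := C (σ t))
    (h := c (σ t) t) ((hK t.1).apex_mem t.2) ((hDK _ _ _ _).mono_left Set.inter_subset_left)
    (fun x hx => by
      have h1 := mem_nbhd_of_attachDist_le (G := G) (K := K t.1 t.2) (a := a t.1) (ρ := ρ) (x := x)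
        (by rw [hCdist _ t x hx]; exact hle t)
      rwa [hCdist _ t x hx] at h1)
    (hfar (σ t) t)
  choose L hheight hapex hbase hheart hvert hpen hinner using hlev
  let T : Fin m → Lobster G n := fun i =>
    { one_le_length := hn
      apex := a i
      member := fun p => L (i, p)
      member_apex := fun p => hapex (i, p)
      heart_disjoint := fun p p' hp => ((hK i).disjoint p p' hp).mono
        (Set.sdiff_subset_sdiff_left (hheart (i, p)))
        (Set.sdiff_subset_sdiff_left (hheart (i, p')))
      edge_condition := fun p p' hp u hu v hv huv => by
        rcases hvert (i, p') hv.1 with hvK | hvB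
        · exact absurd huv
            ((hK i).anticomplete p p' hp u ⟨hheart (i, p) hu.1, hu.2⟩ v ⟨hvK, hv.2⟩)
        · refine ⟨?_, (hbase (i, p')).symm ▸ hvB⟩
          by_contra hup
          obtain ⟨j, hj, huj⟩ := hpen (i, p) u hu.1 hup
          exact hfar (σ (i, p')) (i, p) v hvB j hj ⟨u, huj, huv⟩ }
  refine ⟨T, ⟨?_, ?_, ?_⟩, fun i => ⟨?_, ?_⟩⟩
  · intro i j hij
    refine Set.disjoint_iUnion_left.2 fun p => Set.disjoint_iUnion_right.2 fun p' => ?_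
    exact (hcross i j hij p p').1.mono (hheart (i, p)) (hheart (j, p'))
  · intro i j hij u hu v hv
    obtain ⟨p, hp⟩ := Set.mem_iUnion.1 hu
    obtain ⟨p', hp'⟩ := Set.mem_iUnion.1 hv
    exact (hcross i j hij p p').2 u (hheart (i, p) hp) v (hheart (j, p') hp')
  · intro i j p p' _ u hu v hv huv
    obtain ⟨k, hk, huk⟩ := hinner (i, p) u hu
    have hv' : v ∈ C (σ (j, p')) := hbase (j, p') ▸ hv
    exact hfar _ (i, p) v hv' k hk ⟨u, huk, huv⟩
  · refine Finset.sup_le fun p _ => ?_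
    change (L (i, p)).height ≤ ρ + 1
    rw [hheight]
    exact Nat.succ_le_succ (hle (i, p))
  · have : Nonempty (Fin n) := ⟨⟨0, hn⟩⟩
    obtain ⟨p, hp⟩ := exists_eq_ciInf_of_finite (f := fun p => (L (i, p)).base.ncard)
    have hmass : (T i).mass = (L (i, p)).base.ncard := hp.symm
    rw [hmass, hbase]
    exact hc _

end Troupe

/-! ### Choice of parameters and conclusion. -/

theorem two_mul_le_four_pow (n : ℕ) : 2 * n ≤ 4 ^ n := by
  induction n with
  | zero => norm_num
  | succ n ih =>
    have := Nat.one_le_pow n 4 (by norm_num)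
    rw [pow_succ]
    omega

theorem SparseCoherent.exists_troupe {V : Type*} [Finite V] {G : SimpleGraph V} {α e q : ℝ}
    {r m n : ℕ} (h : SparseCoherent G α e) (hα : 0 < α) (hαe : α ≤ e) (hq : α * q = e)
    (hr : α ≤ q ^ r) (he : 1 ≤ e) (hm : 1 ≤ m) (hn : 1 ≤ n)
    (hV : (2 ^ 2 ^ (2 * n) + 3 * ((m : ℝ) - 1) * n) * ((2 * (r : ℝ) + 4) ^ (m * n) * e) ≤
      Nat.card V) :
    ∃ T : Fin m → Lobster G n, IsTroupe T ∧ ∀ i, (T i).height ≤ 2 * r + 2 ∧ e ≤ (T i).mass := by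
  have he0 : 0 < e := by linarith
  set W : ℝ := (2 * (r : ℝ) + 4) ^ (m * n) * e with hWdef
  have hpow : (4 : ℝ) ^ n ≤ (2 * (r : ℝ) + 4) ^ (m * n) := by
    have hr0 : (0 : ℝ) ≤ r := Nat.cast_nonneg r
    calc (4 : ℝ) ^ n ≤ 4 ^ (m * n) :=
          pow_le_pow_right₀ (by norm_num) (Nat.le_mul_of_pos_left n hm)
      _ ≤ _ := pow_le_pow_left₀ (by norm_num) (by linarith) _
  have hW : 4 * e ≤ W := by
    have : (4 : ℝ) ≤ 4 ^ n := by
      simpa using pow_le_pow_right₀ (by norm_num : (1 : ℝ) ≤ 4) hn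
    exact mul_le_mul_of_nonneg_right (this.trans hpow) he0.le
  -- Removing the `n` members of a skeleton, of size at most `2e` each, costs at most `W` of the
  -- `2W` vertices in `E i p`.
  have hnW : n * (2 * e) ≤ W := by
    have : (2 * n : ℝ) ≤ 4 ^ n := by exact_mod_cast two_mul_le_four_pow n
    have := mul_le_mul_of_nonneg_right (this.trans hpow) he0.le
    linarith
  obtain ⟨a, K, E, hK, hKE, hcross⟩ := h.exists_skeletons hα hαe hq hr hW he hn m Set.univ
    (by rwa [Set.ncard_univ])
  obtain ⟨T, hT, hT'⟩ := PurePairs.exists_troupe he0 hn a K (fun i p => E i p \ ⋃ p', K i p') hK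
    (fun i j hij p p' => ⟨(hcross i j hij p p').1, (hcross i j hij p p').2.1⟩)
    (fun i p j p' => by
      by_cases hij : i = j
      · subst hij
        exact Set.disjoint_left.2 fun x hx hx' => hx.2 (Set.mem_iUnion.2 ⟨p', hx'⟩)
      · exact (hcross i j hij p p').2.2.mono_left Set.sdiff_subset)
    (fun i p x hx => ((hKE i p).2.2.2.1 hx.1).resolve_left fun hxK =>
      hx.2 (Set.mem_iUnion.2 ⟨p, hxK⟩))
    (fun i p => by
      have h1 := cast_ncard_le_diff_add (E i p) (⋃ p', K i p')
      have h2 := cast_ncard_le (Set.inter_subset_left (s := ⋃ p', K i p') (t := E i p))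
      have h3 : ((⋃ p', K i p').ncard : ℝ) ≤ n * (2 * e) := by
        have h4 : (⋃ p', K i p').ncard ≤ ∑ p', (K i p').ncard :=
          Set.ncard_iUnion_le_of_fintype _
        calc ((⋃ p', K i p').ncard : ℝ) ≤ ∑ p', ((K i p').ncard : ℝ) := by exact_mod_cast h4
          _ ≤ ∑ p' : Fin n, 2 * e := Finset.sum_le_sum fun p' _ => (hKE i p').2.2.1
          _ = n * (2 * e) := by simp
      have h4 : (((2 * r + 1 : ℕ) : ℝ) + 2) ^ (m * n) * e ≤ W := by
        push_cast
        exact mul_le_mul_of_nonneg_right (pow_le_pow_left₀ (by positivity) (by linarith) _) he0.le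
      linarith [(hKE i p).2.2.2.2])
  exact ⟨T, hT, hT'⟩

end PurePairs

theorem mainTheorem8 {V : Type*} [Finite V] (G : SimpleGraph V) (hG : 1 < Nat.card V)
    (c : ℝ) (hc : 0 < c) (hc_int : ∃ k : ℤ, 1 / c = (k : ℝ))
    (m n : ℕ) (hm : 1 ≤ m) (hn : 1 ≤ n)
    (ε : ℝ)
    (hε : ε⁻¹ = ((2 : ℝ) ^ (2 ^ (2 * n)) + 3 * ((m : ℝ) - 1) * (n : ℝ)) *
      (2 + 2 / c) ^ (m * n))
    (hsparse : PurePairs.IsSparse G ε)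
    (hcoherent : PurePairs.IsCoherent G
      (ε * (Nat.card V : ℝ) ^ (1 - c)) (ε * (Nat.card V : ℝ))) :
    ∃ T : Fin m → PurePairs.Lobster G n,
      PurePairs.IsTroupe T ∧
      ∀ i, ((T i).height : ℝ) ≤ 2 + 2 / c ∧ ε * (Nat.card V : ℝ) ≤ ((T i).mass : ℝ) := by
  obtain ⟨r, hr⟩ : ∃ r : ℕ, 1 / c = r + 1 := by
    obtain ⟨k, hk⟩ := hc_int
    have hk0 : 0 < k := by
      have : 0 < 1 / c := by positivity
      rw [hk] at this
      exact_mod_cast this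
    obtain ⟨r, hr⟩ := Int.eq_ofNat_of_zero_le (show 0 ≤ k - 1 by omega)
    refine ⟨r, ?_⟩
    rw [hk, show k = r + 1 by omega]
    push_cast
    ring
  have hcr : c * r = 1 - c := by
    field_simp at hr
    linarith
  have h2c : 2 + 2 / c = 2 * (r : ℝ) + 4 := by
    rw [show 2 / c = 2 * (1 / c) by ring, hr]
    ring
  rw [h2c] at hε ⊢
  set N : ℝ := (Nat.card V : ℝ) with hN
  have hN1 : 1 ≤ N := by rw [hN]; exact_mod_cast hG.le
  have hm1 : (1 : ℝ) ≤ m := by exact_mod_cast hm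
  have hA : (1 : ℝ) ≤ 2 ^ 2 ^ (2 * n) + 3 * ((m : ℝ) - 1) * n := by
    have h1 : (1 : ℝ) ≤ 2 ^ 2 ^ (2 * n) := one_le_pow₀ (by norm_num)
    have h2 : 0 ≤ 3 * ((m : ℝ) - 1) * n := by
      have : 0 ≤ (m : ℝ) - 1 := by linarith
      positivity
    linarith
  have hB : (1 : ℝ) ≤ (2 * (r : ℝ) + 4) ^ (m * n) := by
    refine one_le_pow₀ ?_
    have : (0 : ℝ) ≤ r := Nat.cast_nonneg r
    linarith
  have hinv : 1 ≤ ε⁻¹ := hε ▸ one_le_mul_of_one_le_of_one_le hA hB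
  have hε0 : 0 < ε := inv_pos.1 (by linarith)
  have hε1 : ε ≤ 1 := (one_le_inv₀ hε0).1 hinv
  have hN0 : 0 < N := by linarith
  have hαe : ε * N ^ (1 - c) ≤ ε * N := by
    refine mul_le_mul_of_nonneg_left ?_ hε0.le
    calc N ^ (1 - c) ≤ N ^ (1 : ℝ) := Real.rpow_le_rpow_of_exponent_le hN1 (by linarith)
      _ = N := Real.rpow_one N
  have hSC : PurePairs.SparseCoherent G (ε * N ^ (1 - c)) (ε * N) :=
    ⟨hsparse, fun A B hAB hanti hAα => by
      by_contra! hB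
      exact hcoherent ⟨A, B, hAB, hanti, hAα, hB⟩⟩
  -- If `e < 1`, sparsity leaves no edges, and two single vertices already violate coherence.
  have he1 : 1 ≤ ε * N := by
    by_contra! hlt
    obtain ⟨v, w, hvw⟩ := (Finite.one_lt_card_iff_nontrivial.1 hG).exists_pair_ne
    have hdeg : G.neighborSet v = ∅ := by
      have h1 := (hsparse v).trans hlt
      rw [← Set.ncard_eq_zero]
      have : (G.neighborSet v).ncard < 1 := by exact_mod_cast h1
      omega
    refine hcoherent ⟨{v}, {w}, by simpa using hvw, ?_, ?_, ?_⟩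
    · rintro _ rfl b _ hb
      exact (Set.ext_iff.1 hdeg b).1 hb
    · simpa using hαe.trans hlt.le
    · simpa using hlt.le
  obtain ⟨T, hT, hT'⟩ := hSC.exists_troupe (q := N ^ c) (r := r) (m := m) (n := n)
    (by positivity) hαe
    (by rw [mul_assoc, ← Real.rpow_add hN0, sub_add_cancel, Real.rpow_one])
    (by
      rw [← Real.rpow_natCast, ← Real.rpow_mul hN0.le, hcr]
      exact mul_le_of_le_one_left (by positivity) hε1)
    he1 hm hn (by
      rw [← mul_assoc, ← hε, inv_mul_cancel_left₀ hε0.ne'])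
  refine ⟨T, hT, fun i => ⟨?_, (hT' i).2⟩⟩
  have h1 : ((T i).height : ℝ) ≤ 2 * r + 2 := by exact_mod_cast (hT' i).1
  linarith
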